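/- For a prime $p$, let $\widehat{\mathbb{Z}_p}$ be the group of characters of $\mathbb{Z}_p=\mathbb{Z}/p\mathbb{Z}$. For a complex-valued function $F$ on a finite set, let $\|F\|_0$ denote the number of points at which $F$ is nonzero. For $f,g\in\mathbb{C}^{\mathbb{Z}_p}$, let $$V_g f(x,\xi)=\sum_{y\in\mathbb{Z}_p} f(y)\,\overline{g(y-x)}\,\overline{\xi(y)},\qquad (x,\xi)\in\mathbb{Z}_p\times\widehat{\mathbb{Z}_p},$$ be the short-time Fourier transform of $f$ with window $g$. **Theorem.** Let $p$ be prime and let $g\in\mathbb{C}^{\mathbb{Z}_p}$ be such that $\|f\|_0+\|V_g f\|_0\ge p^2+1$ for all $f\in\mathbb{C}^{\mathbb{Z}_p}\setminus\{0\}$. Let $\Lambda\subseteq\mathbb{Z}_p\times\widehat{\mathbb{Z}_p}$. Then every $f\in\mathbb{C}^{\mathbb{Z}_p}$ with $\|f\|_0\le\tfrac12|\Lambda|$ is uniquely determined, among all such functions, by $\Lambda$ and the restriction of $V_g f$ to $\Lambda$: if $f,f'\in\mathbb{C}^{\mathbb{Z}_p}$ satisfy $\|f\|_0\le\tfrac12|\Lambda|$,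 $\|f'\|_0\le\tfrac12|\Lambda|$ and $V_g f(\lambda)=V_g f'(\lambda)$ for all $\lambda\in\Lambda$, then $f=f'$. -/

import Mathlib

open scoped ComplexConjugate

namespace TimeFrequency

variable {G : Type*} [AddCommGroup G]

/-- The dual group of a finite abelian group `G`. On a finite group every homomorphism to the
multiplicative monoid of `ℂ` takes values in the unit circle. -/
abbrev Dual (G : Type*) [AddCommGroup G] : Type _ := AddChar G ℂ

/-- `‖f‖₀`, the number of points where `f` does not vanish. -/
noncomputable def l0 {A : Type*} (f : A → ℂ) : ℕ := (Function.support f).ncard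

/-- Modulation `M_ξ f = f · ξ`. -/
def modulation (ξ : Dual G) (f : G → ℂ) : G → ℂ := fun y => f y * ξ y

/-- The time-frequency shift `π(x, ξ) = M_ξ ∘ T_x`, where `T_x f (y) = f (y - x)`. -/
def timeFrequencyShift (l : G × Dual G) (f : G → ℂ) : G → ℂ :=
  modulation l.2 (translate l.1 f)

/-- The short-time Fourier transform
`V_g f (x, ξ) = ⟨f, π(x, ξ) g⟩ = ∑ y, f y * conj (g (y - x)) * conj (ξ y)`. -/
noncomputable def stft [Fintype G] (g f : G → ℂ) : G × Dual G → ℂ :=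
  fun l => ∑ y, f y * conj (timeFrequencyShift l g y)

/-- The window condition on `ℤ/pℤ`: `‖f‖₀ + ‖V_g f‖₀ ≥ p² + 1` for every nonzero `f`. -/
def IsUncertaintyWindow (p : ℕ) [NeZero p] (g : ZMod p → ℂ) : Prop :=
  ∀ f : ZMod p → ℂ, f ≠ 0 → p ^ 2 + 1 ≤ l0 f + l0 (stft g f)

end TimeFrequency

namespace TimeFrequency

/-! If `f ≠ f'`, the difference `h = f - f'` has at most `|Λ|` nonzero values, while `V_g h`, by
linearity, vanishes on `Λ` and so has at most `p² - |Λ|`. The two counts sum to at most `p²`, one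
short of the window bound. -/

theorem l0_sub_le {A : Type*} [Finite A] (f f' : A → ℂ) : l0 (f - f') ≤ l0 f + l0 f' :=
  (Set.ncard_le_ncard (Function.support_sub f f') (Set.toFinite _)).trans (Set.ncard_union_le _ _)

theorem l0_add_ncard_le {A : Type*} [Finite A] {F : A → ℂ} {s : Set A}
    (h : ∀ a ∈ s, F a = 0) : l0 F + s.ncard ≤ Nat.card A := by
  have hd : Disjoint (Function.support F) s :=
    Set.disjoint_left.2 fun a ha hs => ha (h a hs)
  rw [l0, ← Set.ncard_union_eq hd (Set.toFinite _) (Set.toFinite _)]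
  exact Set.ncard_le_card _

theorem stft_sub {G : Type*} [AddCommGroup G] [Fintype G] (g f f' : G → ℂ) :
    stft g (f - f') = stft g f - stft g f' := by
  funext l
  simp [stft, sub_mul, Finset.sum_sub_distrib]

/-- A finite abelian group has as many complex characters as elements. -/
theorem card_prod_dual (G : Type*) [AddCommGroup G] [Finite G] :
    Nat.card (G × Dual G) = Nat.card G ^ 2 := by
  have := Fintype.ofFinite G
  rw [Nat.card_prod, sq, Nat.card_eq_fintype_card (α := Dual G), AddChar.card_eq,
    Nat.card_eq_fintype_card]

end TimeFrequency

theorem mainTheorem12 (p : ℕ) [Fact p.Prime] (g : ZMod p → ℂ)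
    (hg : TimeFrequency.IsUncertaintyWindow p g)
    (Λ : Set (ZMod p × TimeFrequency.Dual (ZMod p)))
    (f : ZMod p → ℂ) (hf : (TimeFrequency.l0 f : ℝ) ≤ 1 / 2 * (Λ.ncard : ℝ))
    (f' : ZMod p → ℂ) (hf' : (TimeFrequency.l0 f' : ℝ) ≤ 1 / 2 * (Λ.ncard : ℝ))
    (hdata : Λ.domRestrict (TimeFrequency.stft g f) = Λ.domRestrict (TimeFrequency.stft g f')) :
    f = f' := by
  by_contra hne
  have huncertainty := hg (f - f') (sub_ne_zero.2 hne)
  have hvanish : ∀ l ∈ Λ, TimeFrequency.stft g (f - f') l = 0 := fun l hl => by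
    rw [TimeFrequency.stft_sub, Pi.sub_apply, sub_eq_zero]
    exact congrFun hdata ⟨l, hl⟩
  have hstft := TimeFrequency.l0_add_ncard_le hvanish
  rw [TimeFrequency.card_prod_dual, Nat.card_zmod] at hstft
  have hsupp := TimeFrequency.l0_sub_le f f'
  have hsum : TimeFrequency.l0 f + TimeFrequency.l0 f' ≤ Λ.ncard := by
    have : (TimeFrequency.l0 f + TimeFrequency.l0 f' : ℝ) ≤ Λ.ncard := by linarith
    exact_mod_cast this
  -- With `p ^ 2` as an atom, the bounds combine to `p ^ 2 + 1 ≤ p ^ 2`.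
  omega
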